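/- Let $\mathbb K\in\{\mathbb R,\mathbb C\}$ and let $X$ be a $k_\omega$-space, i.e. a Hausdorff topological space for which there are compact subsets $K_1\subseteq K_2\subseteq\cdots$ with $\bigcup_n K_n=X$ such that $X=\varinjlim K_n$ as a topological space (a set $U\subseteq X$ is open if and only if $U\cap K_n$ is relatively open in $K_n$ for every $n$). Let $E=L(X)$ be the free locally convex space over $X$, i.e. the free $\mathbb K$-vector space $\mathbb K^{(X)}$ on the set $X$, equipped with the finest locally convex vector topology making the canonical map $X\to\mathbb K^{(X)}$, $x\mapsto\delta_x$, continuous. (Topological vector spaces are not assumed to be Hausdorff.) Put $T^0_\pi(E):=\mathbb K$, $T^1_\pi(E):=E$ and $T^{j+1}_\pi(E):=E\otimes_\pi T^j_\pi(E)$ for $j\ge 1$, where $\otimes_\pi$ is the projective tensor product, i.e. the tensor product with the finest locally convex vector topology making $(x,y)\mapsto x\otimes y$ continuous. Let $T_\pi(E):=\bigoplus_{j\ge 0}T^j_\pi(E)$ be the tensor algebra of $E$, equipped with the locally convex direct sum topology (the box topology: the sets $\bigoplus_j U_j$ of all $(x_j)_j$ with $x_j\in U_j$ for all $j$, where $U_j$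 is a $0$-neighbourhood in $T^j_\pi(E)$, form a basis of $0$-neighbourhoods). Then $T_\pi(E)$ is a topological algebra: it is a topological vector space, and the multiplication $T_\pi(E)\times T_\pi(E)\to T_\pi(E)$ of the tensor algebra is jointly continuous. -/

import Mathlib

open scoped TensorProduct DirectSum Topology

noncomputable section

/-- A Hausdorff space `X` is a `k_ω`-space if it is the direct limit, as a topological space, of an
ascending sequence of compact subsets with union `X`. -/
structure IsKOmegaSpace (X : Type*) [TopologicalSpace X] : Prop where
  t2 : T2Space X
  exists_seq : ∃ K : ℕ → Set X, Monotone K ∧ (∀ n, IsCompact (K n)) ∧ (⋃ n, K n) = Set.univ ∧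
    ∀ U : Set X, IsOpen U ↔ ∀ n, IsOpen ((↑) ⁻¹' U : Set (K n))

open scoped ComplexOrder in
/-- `t` is a locally convex vector topology on the `𝕜`-vector space `V`. For the order of `𝕜` used
here, the non-negative elements of `𝕜` are the non-negative reals, so that `Convex 𝕜` and
`LocallyConvexSpace 𝕜` have their usual meaning. -/
structure IsLocallyConvexTopology (𝕜 : Type*) [RCLike 𝕜] {V : Type*} [AddCommGroup V] [Module 𝕜 V]
    (t : TopologicalSpace V) : Prop where
  isTopologicalAddGroup : @IsTopologicalAddGroup V t _
  continuousSMul : @ContinuousSMul 𝕜 V _ _ t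
  locallyConvex : @LocallyConvexSpace 𝕜 V _ _ _ _ t

/-- The finest locally convex vector topology on `V` for which `f : S → V` is continuous.
(In Mathlib's order on topologies the finest one is the infimum.) -/
@[reducible] def finestLocallyConvexTopology (𝕜 : Type*) [RCLike 𝕜] {S V : Type*} [TopologicalSpace S]
    [AddCommGroup V] [Module 𝕜 V] (f : S → V) : TopologicalSpace V :=
  sInf {t | IsLocallyConvexTopology 𝕜 t ∧ Continuous[_, t] f}

open scoped ComplexOrder in
/-- The infimum above really belongs to the set: it is a locally convex vector topology making
`f` continuous, hence the finest such topology. -/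
theorem finestLocallyConvexTopology_isLeast (𝕜 : Type*) [RCLike 𝕜] {S V : Type*}
    [TopologicalSpace S] [AddCommGroup V] [Module 𝕜 V] (f : S → V) :
    IsLeast {t : TopologicalSpace V | IsLocallyConvexTopology 𝕜 t ∧ Continuous[_, t] f}
      (finestLocallyConvexTopology 𝕜 f) := by
  refine ⟨⟨⟨?_, ?_, ?_⟩, ?_⟩, fun t ht => sInf_le ht⟩
  · exact topologicalAddGroup_sInf fun t ht => ht.1.isTopologicalAddGroup
  · exact continuousSMul_sInf fun t ht => ht.1.continuousSMul
  · exact LocallyConvexSpace.sInf fun t ht => ht.1.locallyConvex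
  · exact continuous_sInf_rng.2 fun t ht => ht.2

/-- The free locally convex space `L(X)` over a topological space `X`: the free vector space on the
set `X`, with the finest locally convex vector topology for which `x ↦ δ_x` is continuous. -/
def FreeLCS (𝕜 : Type*) [RCLike 𝕜] (X : Type*) [TopologicalSpace X] : Type _ := X →₀ 𝕜

namespace FreeLCS

variable (𝕜 : Type*) [RCLike 𝕜] (X : Type*) [TopologicalSpace X]

instance : AddCommGroup (FreeLCS 𝕜 X) := inferInstanceAs (AddCommGroup (X →₀ 𝕜))

instance : Module 𝕜 (FreeLCS 𝕜 X) := inferInstanceAs (Module 𝕜 (X →₀ 𝕜))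

/-- The canonical map `η_X : X → L(X)`. -/
def η (x : X) : FreeLCS 𝕜 X := (Finsupp.single x 1 : X →₀ 𝕜)

instance : TopologicalSpace (FreeLCS 𝕜 X) := finestLocallyConvexTopology 𝕜 (η 𝕜 X)

end FreeLCS

/-- The projective tensor product topology on `E ⊗ F`: the finest locally convex vector topology for
which `(x, y) ↦ x ⊗ y` is continuous. -/
@[reducible] def projTopology (𝕜 : Type*) [RCLike 𝕜] (E F : Type*) [AddCommGroup E] [Module 𝕜 E]
    [TopologicalSpace E] [AddCommGroup F] [Module 𝕜 F] [TopologicalSpace F] :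
    TopologicalSpace (E ⊗[𝕜] F) :=
  finestLocallyConvexTopology 𝕜 (fun p : E × F => p.1 ⊗ₜ[𝕜] p.2)

section TensorPowers

variable (𝕜 : Type*) [RCLike 𝕜] (E : Type*) [AddCommGroup E] [Module 𝕜 E]

/-- The linear isomorphism `E ⊗ T^n(E) ≃ T^{n+1}(E)`,
`x ⊗ (y₁ ⊗ ⋯ ⊗ yₙ) ↦ x ⊗ y₁ ⊗ ⋯ ⊗ yₙ`. -/
def tensorPowerCons (n : ℕ) : E ⊗[𝕜] (⨂[𝕜]^n E) ≃ₗ[𝕜] ⨂[𝕜]^(n + 1) E :=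
  (TensorProduct.congr (PiTensorProduct.subsingletonEquiv (0 : Fin 1)).symm
      (LinearEquiv.refl 𝕜 (⨂[𝕜]^n E))).trans
    (TensorPower.mulEquiv.trans (TensorPower.cast 𝕜 E (add_comm 1 n)))

theorem tensorPowerCons_tmul_tprod (n : ℕ) (x : E) (y : Fin n → E) :
    tensorPowerCons 𝕜 E n (x ⊗ₜ PiTensorProduct.tprod 𝕜 y) =
      PiTensorProduct.tprod 𝕜 (Fin.cons x y : Fin (n + 1) → E) := by
  have h : (PiTensorProduct.subsingletonEquiv (0 : Fin 1) : (⨂[𝕜]^1 E) ≃ₗ[𝕜] E).symm x =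
      PiTensorProduct.tprod 𝕜 (fun _ : Fin 1 => x) := by
    rw [LinearEquiv.symm_apply_eq]
    simp
  simp only [tensorPowerCons, LinearEquiv.trans_apply, TensorProduct.congr_tmul, h,
    LinearEquiv.refl_apply]
  rw [← TensorPower.gMul_def, TensorPower.tprod_mul_tprod, TensorPower.cast_tprod]
  congr 1
  rw [Fin.append_left_eq_cons]
  funext i
  simp

/-- The topology of the projective tensor power `T^n_π(E)`, by recursion: `T^0_π(E) = 𝕜`,
`T^1_π(E) = E` and `T^{n+2}_π(E) = E ⊗_π T^{n+1}_π(E)`. -/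
@[reducible] def tensorPowerTopology [TopologicalSpace E] : ∀ n : ℕ, TopologicalSpace (⨂[𝕜]^n E)
  | 0 => .induced (PiTensorProduct.isEmptyEquiv (Fin 0) : (⨂[𝕜]^0 E) ≃ₗ[𝕜] 𝕜) inferInstance
  | 1 => .induced (PiTensorProduct.subsingletonEquiv (0 : Fin 1) : (⨂[𝕜]^1 E) ≃ₗ[𝕜] E)
      inferInstance
  | n + 2 =>
    letI := tensorPowerTopology (n + 1)
    .induced (tensorPowerCons 𝕜 E (n + 1)).symm (projTopology 𝕜 E (⨂[𝕜]^(n + 1) E))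

end TensorPowers

/-- The box topology on a direct sum: a basis of open sets is given by the sets
`⨁ U_i := {x | ∀ i, x_i ∈ U_i}` with every `U_i` open. -/
@[reducible] def boxTopology {ι : Type*} {A : ι → Type*} [∀ i, AddCommMonoid (A i)]
    (t : ∀ i, TopologicalSpace (A i)) : TopologicalSpace (⨁ i, A i) :=
  .generateFrom {s | ∃ U : ∀ i, Set (A i), (∀ i, IsOpen[t i] (U i)) ∧ s = {x | ∀ i, x i ∈ U i}}

/-- The tensor algebra `T_π(E) = ⨁ n, T^n_π(E)`, with the usual multiplication
`(x₁ ⊗ ⋯ ⊗ xᵢ) (y₁ ⊗ ⋯ ⊗ yⱼ) = x₁ ⊗ ⋯ ⊗ xᵢ ⊗ y₁ ⊗ ⋯ ⊗ yⱼ`, topologized as the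
locally convex direct sum of the projective tensor powers. -/
def ProjTensorAlgebra (𝕜 : Type*) [RCLike 𝕜] (E : Type*) [AddCommGroup E] [Module 𝕜 E] : Type _ :=
  ⨁ n : ℕ, ⨂[𝕜]^n E

namespace ProjTensorAlgebra

variable (𝕜 : Type*) [RCLike 𝕜] (E : Type*) [AddCommGroup E] [Module 𝕜 E]

instance : Semiring (ProjTensorAlgebra 𝕜 E) := inferInstanceAs (Semiring (⨁ n : ℕ, ⨂[𝕜]^n E))

instance : AddCommGroup (ProjTensorAlgebra 𝕜 E) :=
  inferInstanceAs (AddCommGroup (⨁ n : ℕ, ⨂[𝕜]^n E))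

instance : Ring (ProjTensorAlgebra 𝕜 E) :=
  { (inferInstance : Semiring (ProjTensorAlgebra 𝕜 E)),
    (inferInstance : AddCommGroup (ProjTensorAlgebra 𝕜 E)) with }

instance : Algebra 𝕜 (ProjTensorAlgebra 𝕜 E) := inferInstanceAs (Algebra 𝕜 (⨁ n : ℕ, ⨂[𝕜]^n E))

instance [TopologicalSpace E] : TopologicalSpace (ProjTensorAlgebra 𝕜 E) :=
  boxTopology (tensorPowerTopology 𝕜 E)

end ProjTensorAlgebra

/-- A topological algebra is a topological vector space `A` with a continuous bilinear
map `A × A → A`. -/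
structure IsTopologicalAlgebraWith (𝕜 : Type*) [RCLike 𝕜] {A : Type*} [AddCommGroup A] [Module 𝕜 A]
    [TopologicalSpace A] (β : A →ₗ[𝕜] A →ₗ[𝕜] A) : Prop where
  isTopologicalAddGroup : IsTopologicalAddGroup A
  continuousSMul : ContinuousSMul 𝕜 A
  continuous_mul : Continuous fun p : A × A => β p.1 p.2

end

/-! Joint continuity follows if each defining seminorm `∑ p_n` of the direct sum satisfies
`p_{i+j}(u v) ≤ S_i(u) S_j(v)` for continuous `S_n`. Each `p_n` is bounded by a multiple of the
projective power of some continuous seminorm `r_n` on `E`. The obstacle is that `r_{i+j}` depends on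
`i + j`, whereas `S_i` may depend only on `i`. A single continuous `q` with `r_n ≤ c_n q` for all
`n` removes it: `p_n ≤ D_n q^{⊗n}`, the powers of `q` are submultiplicative, and numbers `D_{i+j}`
can always be bounded by products `a_i a_j`.

Such a `q` exists on `L(X)` (`FreeLCS.exists_seminorm_ge`): a suitably weighted sum of the `r_n`
converges uniformly on every `K_n`, hence is continuous along `X = lim K_n`, and this suffices by
the universal property of `L(X)`. `ProjTensorAlgebra.isTopologicalAlgebraWith` carries out the
reduction. -/

/-! ### Locally convex topologies and bilinear estimates via seminorms. -/

section Seminorms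

variable {𝕜 : Type*} [RCLike 𝕜]

open scoped ComplexOrder in
/-- A locally convex vector topology is generated by its continuous seminorms. -/
theorem IsLocallyConvexTopology.exists_seminorm_ball_subset {V : Type*} [AddCommGroup V]
    [Module 𝕜 V] [t : TopologicalSpace V] (ht : IsLocallyConvexTopology 𝕜 t) {U : Set V}
    (hU : U ∈ 𝓝 0) : ∃ p : Seminorm 𝕜 V, Continuous p ∧ p.ball 0 1 ⊆ U := by
  have := ht.isTopologicalAddGroup
  have := ht.continuousSMul
  have := ht.locallyConvex
  let : Module ℝ V := Module.compHom V (algebraMap ℝ 𝕜)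
  have hsmul : ∀ (r : ℝ) (x : V), r • x = (r : 𝕜) • x := fun _ _ => rfl
  have : IsScalarTower ℝ 𝕜 V :=
    ⟨fun r z x => by rw [hsmul, smul_smul, RCLike.real_smul_eq_coe_mul]⟩
  have : ContinuousSMul ℝ V :=
    ⟨(RCLike.continuous_ofReal.comp continuous_fst).smul continuous_snd⟩
  have hw := with_gaugeSeminormFamily (𝕜 := 𝕜) (E := V)
  obtain ⟨i, r, hr, hi⟩ := (hw.mem_nhds_iff 0 U).1 hU
  have hc : Continuous (i.sup (gaugeSeminormFamily 𝕜 V) : Seminorm 𝕜 V) :=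
    Seminorm.continuous_finsetSup fun j _ => hw.continuous_seminorm j
  lift r to NNReal using hr.le
  refine ⟨r⁻¹ • i.sup (gaugeSeminormFamily 𝕜 V), hc.const_smul r⁻¹, fun x hx => hi ?_⟩
  rw [Seminorm.mem_ball_zero, smul_apply, NNReal.smul_def, smul_eq_mul, NNReal.coe_inv,
    inv_mul_lt_iff₀ hr, mul_one] at hx
  rwa [Seminorm.mem_ball_zero]

open scoped ComplexOrder in
theorem IsLocallyConvexTopology.induced {V W : Type*} [AddCommGroup V] [Module 𝕜 V]
    [AddCommGroup W] [Module 𝕜 W] {t : TopologicalSpace W} (ht : IsLocallyConvexTopology 𝕜 t)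
    (f : V →ₗ[𝕜] W) : IsLocallyConvexTopology 𝕜 (t.induced f) := by
  have := ht.isTopologicalAddGroup
  have := ht.continuousSMul
  have := ht.locallyConvex
  exact ⟨topologicalAddGroup_induced f, continuousSMul_induced f, LocallyConvexSpace.induced f⟩

open scoped ComplexOrder in
theorem WithSeminorms.isLocallyConvexTopology {V ι : Type*} [Nonempty ι] [AddCommGroup V]
    [Module 𝕜 V] {t : TopologicalSpace V} {p : SeminormFamily 𝕜 V ι} (hp : WithSeminorms p) :
    IsLocallyConvexTopology 𝕜 t := by
  let : Module ℝ V := Module.compHom V (algebraMap ℝ 𝕜)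
  have : IsScalarTower ℝ 𝕜 V :=
    ⟨fun r z x => by
      change _ = (r : 𝕜) • (z • x)
      rw [smul_smul, RCLike.real_smul_eq_coe_mul]⟩
  have := hp.topologicalAddGroup
  refine ⟨this, hp.continuousSMul, ?_⟩
  refine LocallyConvexSpace.ofBasisZero 𝕜 V _ _ hp.hasBasis ?_
  intro s hs
  obtain ⟨i, r, hr, rfl⟩ := (SeminormFamily.basisSets_iff _).1 hs
  exact convex_RCLike_iff_convex_real.2 (Seminorm.convex_ball _ _ _)

/-- A seminorm is continuous for the finest locally convex topology making `f` continuous as soon as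
`f` is continuous for the topology defined by that seminorm. -/
theorem continuous_seminorm_finestLocallyConvexTopology {S V : Type*} [TopologicalSpace S]
    [AddCommGroup V] [Module 𝕜 V] {f : S → V} (p : Seminorm 𝕜 V)
    (h : ∀ s₀, Filter.Tendsto (fun s => p (f s - f s₀)) (𝓝 s₀) (𝓝 0)) :
    Continuous[finestLocallyConvexTopology 𝕜 f, _] p := by
  let F : SeminormFamily 𝕜 V Unit := fun _ => p
  let t : TopologicalSpace V := F.moduleFilterBasis.topology
  have hF : WithSeminorms F := ⟨rfl⟩
  have ht : Continuous f := by
    refine continuous_iff_continuousAt.2 fun s₀ => ?_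
    rw [ContinuousAt, hF.tendsto_nhds]
    exact fun _ ε hε => (h s₀).eventually_lt_const hε
  have hle : finestLocallyConvexTopology 𝕜 f ≤ t :=
    (finestLocallyConvexTopology_isLeast 𝕜 f).2 ⟨hF.isLocallyConvexTopology, ht⟩
  exact continuous_le_dom hle (hF.continuous_seminorm ())

/-- Split `B(x, y) - B(x₀, y₀)` as `B(x - x₀, y) + B(x₀, y - y₀)`. This serves both the projective
tensor product and the final multiplication. -/
theorem Seminorm.tendsto_bilin_sub {E F V : Type*} [AddCommGroup E] [Module 𝕜 E]
    [AddCommGroup F] [Module 𝕜 F] [AddCommGroup V] [Module 𝕜 V]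
    [TopologicalSpace E] [IsTopologicalAddGroup E] [TopologicalSpace F] [IsTopologicalAddGroup F]
    (B : E →ₗ[𝕜] F →ₗ[𝕜] V) {R : Seminorm 𝕜 V} {p : Seminorm 𝕜 E} {q : Seminorm 𝕜 F}
    (hp : Continuous p) (hq : Continuous q) (h : ∀ x y, R (B x y) ≤ p x * q y) (z₀ : E × F) :
    Filter.Tendsto (fun z : E × F => R (B z.1 z.2 - B z₀.1 z₀.2)) (𝓝 z₀) (𝓝 0) := by
  have hb : ∀ z : E × F, R (B z.1 z.2 - B z₀.1 z₀.2) ≤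
      p (z.1 - z₀.1) * q z.2 + p z₀.1 * q (z.2 - z₀.2) := fun z => by
    have : B z.1 z.2 - B z₀.1 z₀.2 = B (z.1 - z₀.1) z.2 + B z₀.1 (z.2 - z₀.2) := by
      simp
    rw [this]
    exact (map_add_le_add R _ _).trans (add_le_add (h _ _) (h _ _))
  refine squeeze_zero (fun _ => apply_nonneg _ _) hb ?_
  have hc : Continuous fun z : E × F =>
      p (z.1 - z₀.1) * q z.2 + p z₀.1 * q (z.2 - z₀.2) := by fun_prop
  simpa using hc.tendsto z₀

/-- The pointwise sum of a pointwise summable family of seminorms. -/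
noncomputable def Seminorm.tsum {V ι : Type*} [AddCommGroup V] [Module 𝕜 V] (p : ι → Seminorm 𝕜 V)
    (h : ∀ x, Summable fun i => p i x) : Seminorm 𝕜 V :=
  Seminorm.of (fun x => ∑' i, p i x)
    (fun x y => by
      rw [← (h x).tsum_add (h y)]
      exact (h (x + y)).tsum_le_tsum (fun i => map_add_le_add (p i) x y) ((h x).add (h y)))
    (fun a x => by simp_rw [map_smul_eq_mul, tsum_mul_left])

/-- If `B` is bilinear and `(x, y) ↦ R (B x y)` is continuous, then `R (B x y) ≤ p x * q y` for
suitable continuous seminorms `p`, `q`. -/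
theorem IsLocallyConvexTopology.exists_bilin_le {E F V : Type*} [AddCommGroup E] [Module 𝕜 E]
    [AddCommGroup F] [Module 𝕜 F] [AddCommGroup V] [Module 𝕜 V]
    [tE : TopologicalSpace E] [tF : TopologicalSpace F] (hE : IsLocallyConvexTopology 𝕜 tE)
    (hF : IsLocallyConvexTopology 𝕜 tF) (B : E →ₗ[𝕜] F →ₗ[𝕜] V) (R : Seminorm 𝕜 V)
    (h : Continuous fun z : E × F => R (B z.1 z.2)) :
    ∃ (p : Seminorm 𝕜 E) (q : Seminorm 𝕜 F), Continuous p ∧ Continuous q ∧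
      ∀ x y, R (B x y) ≤ p x * q y := by
  have h0 : ∀ᶠ z : E × F in 𝓝 0, R (B z.1 z.2) < 1 :=
    (h.tendsto' 0 0 (by simp)).eventually_lt_const one_pos
  obtain ⟨U, hU, W, hW, hUW⟩ := mem_nhds_prod_iff.1 (show _ ∈ 𝓝 ((0 : E), (0 : F)) from h0)
  obtain ⟨p, hp, hpU⟩ := hE.exists_seminorm_ball_subset hU
  obtain ⟨q, hq, hqW⟩ := hF.exists_seminorm_ball_subset hW
  have key : ∀ x y, p x < 1 → q y < 1 → R (B x y) < 1 := fun x y hx hy =>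
    @hUW (x, y) ⟨hpU (p.mem_ball_zero.2 hx), hqW (q.mem_ball_zero.2 hy)⟩
  -- Homogeneity, with strict bounds `s`, `t` so that `p x = 0` or `q y = 0` needs no separate case;
  -- afterwards `s` and `t` decrease to `p x` and `q y`.
  have key2 : ∀ x y (s t : ℝ), p x < s → q y < t → R (B x y) ≤ s * t := fun x y s t hs ht => by
    have hs0 : 0 < s := (apply_nonneg p x).trans_lt hs
    have ht0 : 0 < t := (apply_nonneg q y).trans_lt ht
    have := key (((s⁻¹ : ℝ) : 𝕜) • x) (((t⁻¹ : ℝ) : 𝕜) • y)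
      (by rw [map_smul_eq_mul, RCLike.norm_ofReal, abs_of_pos (by positivity),
            inv_mul_lt_iff₀ hs0, mul_one]; exact hs)
      (by rw [map_smul_eq_mul, RCLike.norm_ofReal, abs_of_pos (by positivity),
            inv_mul_lt_iff₀ ht0, mul_one]; exact ht)
    rw [LinearMap.map_smul₂, (B x).map_smul, map_smul_eq_mul, map_smul_eq_mul, RCLike.norm_ofReal,
      RCLike.norm_ofReal, abs_of_pos (by positivity), abs_of_pos (by positivity),
      inv_mul_lt_iff₀ hs0, inv_mul_lt_iff₀ ht0] at this
    linarith
  refine ⟨p, q, hp, hq, fun x y => ?_⟩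
  have hlim : Filter.Tendsto (fun ε : ℝ => (p x + ε) * (q y + ε)) (𝓝[>] 0) (𝓝 (p x * q y)) := by
    have hc : Continuous fun ε : ℝ => (p x + ε) * (q y + ε) := by fun_prop
    simpa using (hc.tendsto 0).mono_left nhdsWithin_le_nhds
  refine ge_of_tendsto hlim ?_
  filter_upwards [self_mem_nhdsWithin] with ε hε
  exact key2 x y _ _ (by linarith [Set.mem_Ioi.1 hε]) (by linarith [Set.mem_Ioi.1 hε])

end Seminorms

/-! ### Projective tensor powers of seminorms. -/

section ProjectiveSeminorm

variable {𝕜 : Type*} [RCLike 𝕜] {E : Type*} [AddCommGroup E] [Module 𝕜 E]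

/-- The `n`-th projective tensor power of a seminorm `q`: the largest seminorm `R` on `T^n(E)` with
`R (y₁ ⊗ ⋯ ⊗ yₙ) ≤ q y₁ ⋯ q yₙ`. -/
noncomputable def Seminorm.tensorPower (q : Seminorm 𝕜 E) (n : ℕ) : Seminorm 𝕜 (⨂[𝕜]^n E) :=
  sSup {R | ∀ y, R (PiTensorProduct.tprod 𝕜 y) ≤ ∏ i, q (y i)}

/-- Writing `x` as a sum of pure tensors bounds all competing `R x` at once; this makes the `sSup` a
genuine pointwise supremum. -/
theorem Seminorm.tensorPower_bddAbove (q : Seminorm 𝕜 E) (n : ℕ) :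
    BddAbove {R : Seminorm 𝕜 (⨂[𝕜]^n E) |
      ∀ y, R (PiTensorProduct.tprod 𝕜 y) ≤ ∏ i, q (y i)} := by
  have hb : ∀ x : ⨂[𝕜]^n E, ∃ M : ℝ, ∀ R : Seminorm 𝕜 (⨂[𝕜]^n E),
      (∀ y, R (PiTensorProduct.tprod 𝕜 y) ≤ ∏ i, q (y i)) → R x ≤ M := fun x => by
    induction x using PiTensorProduct.induction_on with
    | smul_tprod r f =>
      refine ⟨‖r‖ * ∏ i, q (f i), fun R hR => ?_⟩
      rw [map_smul_eq_mul]
      exact mul_le_mul_of_nonneg_left (hR f) (norm_nonneg _)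
    | add x y hx hy =>
      obtain ⟨M, hM⟩ := hx
      obtain ⟨N, hN⟩ := hy
      exact ⟨M + N, fun R hR => (map_add_le_add R x y).trans (add_le_add (hM R hR) (hN R hR))⟩
  choose M hM using hb
  rw [Seminorm.bddAbove_iff]
  refine ⟨M, ?_⟩
  rintro _ ⟨R, hR, rfl⟩ x
  exact hM x R hR

theorem Seminorm.tensorPower_tprod_le (q : Seminorm 𝕜 E) (n : ℕ) (y : Fin n → E) :
    q.tensorPower n (PiTensorProduct.tprod 𝕜 y) ≤ ∏ i, q (y i) := by
  rw [Seminorm.tensorPower, Seminorm.sSup_apply (q.tensorPower_bddAbove n)]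
  exact Real.iSup_le (fun R => R.2 y) (Finset.prod_nonneg fun i _ => apply_nonneg _ _)

theorem Seminorm.le_mul_tensorPower (q : Seminorm 𝕜 E) {n : ℕ} {R : Seminorm 𝕜 (⨂[𝕜]^n E)} {c : ℝ}
    (hc : 0 ≤ c) (h : ∀ y, R (PiTensorProduct.tprod 𝕜 y) ≤ c * ∏ i, q (y i)) (x : ⨂[𝕜]^n E) :
    R x ≤ c * q.tensorPower n x := by
  rcases hc.eq_or_lt with rfl | hc
  · rw [zero_mul]
    induction x using PiTensorProduct.induction_on with
    | smul_tprod r f =>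
      rw [map_smul_eq_mul]
      refine mul_nonpos_of_nonneg_of_nonpos (norm_nonneg _) ((h f).trans_eq (zero_mul _))
    | add x y hx hy => exact (map_add_le_add R x y).trans (by linarith)
  · lift c to NNReal using hc.le
    have hmem : c⁻¹ • R ∈ {R : Seminorm 𝕜 (⨂[𝕜]^n E) |
        ∀ y, R (PiTensorProduct.tprod 𝕜 y) ≤ ∏ i, q (y i)} := fun y => by
      rw [smul_apply, NNReal.smul_def, smul_eq_mul, NNReal.coe_inv, inv_mul_le_iff₀ hc]
      exact h y
    have := le_csSup (q.tensorPower_bddAbove n) hmem x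
    rwa [smul_apply, NNReal.smul_def, smul_eq_mul, NNReal.coe_inv,
      inv_mul_le_iff₀ hc] at this

/-- The estimate is clear on pure tensors; maximality of the projective power extends it in one
variable at a time. -/
theorem Seminorm.tensorPower_gMul_le (q : Seminorm 𝕜 E) {i j : ℕ} (x : ⨂[𝕜]^i E)
    (y : ⨂[𝕜]^j E) :
    q.tensorPower (i + j) (TensorPower.mulEquiv (x ⊗ₜ[𝕜] y)) ≤
      q.tensorPower i x * q.tensorPower j y := by
  let B : (⨂[𝕜]^i E) →ₗ[𝕜] (⨂[𝕜]^j E) →ₗ[𝕜] ⨂[𝕜]^(i + j) E :=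
    (TensorProduct.mk 𝕜 _ _).compr₂ TensorPower.mulEquiv.toLinearMap
  have h1 : ∀ (a : Fin i → E) (b : Fin j → E), q.tensorPower (i + j)
      (B (PiTensorProduct.tprod 𝕜 a) (PiTensorProduct.tprod 𝕜 b)) ≤
        (∏ k, q (a k)) * ∏ k, q (b k) := fun a b => by
    have : B (PiTensorProduct.tprod 𝕜 a) (PiTensorProduct.tprod 𝕜 b) =
        PiTensorProduct.tprod 𝕜 (Fin.append a b) := TensorPower.tprod_mul_tprod 𝕜 a b
    rw [this]
    refine (q.tensorPower_tprod_le _ _).trans_eq ?_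
    simp [Fin.prod_univ_add]
  have h2 : ∀ a : Fin i → E, q.tensorPower (i + j) (B (PiTensorProduct.tprod 𝕜 a) y) ≤
      (∏ k, q (a k)) * q.tensorPower j y := fun a =>
    q.le_mul_tensorPower (R := (q.tensorPower (i + j)).comp (B (PiTensorProduct.tprod 𝕜 a)))
      (Finset.prod_nonneg fun i _ => apply_nonneg _ _) (h1 a) y
  have h3 := q.le_mul_tensorPower (R := (q.tensorPower (i + j)).comp (B.flip y))
    (apply_nonneg (q.tensorPower j) y) (fun a => (h2 a).trans_eq (mul_comm _ _)) x
  exact h3.trans_eq (mul_comm _ _)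

theorem Seminorm.tensorPower_cons_le (q : Seminorm 𝕜 E) {n : ℕ} (x : E) (y : ⨂[𝕜]^n E) :
    q.tensorPower (n + 1) (tensorPowerCons 𝕜 E n (x ⊗ₜ[𝕜] y)) ≤ q x * q.tensorPower n y := by
  refine q.le_mul_tensorPower (R := (q.tensorPower (n + 1)).comp
    ((tensorPowerCons 𝕜 E n).toLinearMap ∘ₗ TensorProduct.mk 𝕜 E _ x)) (apply_nonneg q x)
    (fun a => ?_) y
  simp only [Seminorm.comp_apply, LinearMap.comp_apply, TensorProduct.mk_apply,
    LinearEquiv.coe_coe, tensorPowerCons_tmul_tprod]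
  refine (q.tensorPower_tprod_le _ _).trans_eq ?_
  simp [Fin.prod_univ_succ]

variable [t : TopologicalSpace E]

theorem isLocallyConvexTopology_self :
    IsLocallyConvexTopology 𝕜 (inferInstance : TopologicalSpace 𝕜) :=
  (norm_withSeminorms 𝕜 𝕜).isLocallyConvexTopology

theorem isLocallyConvexTopology_tensorPowerTopology (hE : IsLocallyConvexTopology 𝕜 t) :
    ∀ n, IsLocallyConvexTopology 𝕜 (tensorPowerTopology 𝕜 E n)
  | 0 => isLocallyConvexTopology_self.induced
      (PiTensorProduct.isEmptyEquiv (Fin 0) : (⨂[𝕜]^0 E) ≃ₗ[𝕜] 𝕜).toLinearMap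
  | 1 => hE.induced
      (PiTensorProduct.subsingletonEquiv (0 : Fin 1) : (⨂[𝕜]^1 E) ≃ₗ[𝕜] E).toLinearMap
  | n + 2 => by
    let := tensorPowerTopology 𝕜 E (n + 1)
    exact (finestLocallyConvexTopology_isLeast 𝕜
      (fun p : E × (⨂[𝕜]^(n + 1) E) => p.1 ⊗ₜ[𝕜] p.2)).1.1.induced
        (tensorPowerCons 𝕜 E (n + 1)).symm.toLinearMap

theorem Seminorm.continuous_tensorPower (hE : IsLocallyConvexTopology 𝕜 t) {q : Seminorm 𝕜 E}
    (hq : Continuous q) : ∀ n, Continuous[tensorPowerTopology 𝕜 E n, _] (q.tensorPower n)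
  | 0 => by
    let := tensorPowerTopology 𝕜 E 0
    have hc : Continuous (PiTensorProduct.isEmptyEquiv (Fin 0) : (⨂[𝕜]^0 E) ≃ₗ[𝕜] 𝕜) :=
      continuous_induced_dom
    -- `T^0` is one-dimensional, so every seminorm on it is a multiple of the norm.
    have heq : ∀ x : ⨂[𝕜]^0 E, q.tensorPower 0 x =
        ‖(PiTensorProduct.isEmptyEquiv (Fin 0) : (⨂[𝕜]^0 E) ≃ₗ[𝕜] 𝕜) x‖ *
          q.tensorPower 0 ((PiTensorProduct.isEmptyEquiv (Fin 0)).symm (1 : 𝕜)) := fun x => by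
      rw [← map_smul_eq_mul, ← map_smul, smul_eq_mul, mul_one, LinearEquiv.symm_apply_apply]
    exact (continuous_congr heq).2 (hc.norm.mul continuous_const)
  | 1 => by
    let := tensorPowerTopology 𝕜 E 1
    have := (isLocallyConvexTopology_tensorPowerTopology hE 1).isTopologicalAddGroup
    let e : (⨂[𝕜]^1 E) ≃ₗ[𝕜] E := PiTensorProduct.subsingletonEquiv (0 : Fin 1)
    have hc : Continuous e := continuous_induced_dom
    refine Seminorm.continuous_of_le (q := q.comp e.toLinearMap) (hq.comp hc) fun x => ?_
    have hx : x = PiTensorProduct.tprod 𝕜 (fun _ : Fin 1 => e x) := by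
      apply e.injective
      simp [e]
    conv_lhs => rw [hx]
    refine (q.tensorPower_tprod_le _ _).trans_eq ?_
    simp
  | n + 2 => by
    let := tensorPowerTopology 𝕜 E (n + 1)
    let tp : TopologicalSpace (E ⊗[𝕜] (⨂[𝕜]^(n + 1) E)) := projTopology 𝕜 E (⨂[𝕜]^(n + 1) E)
    have := hE.isTopologicalAddGroup
    have : IsTopologicalAddGroup (⨂[𝕜]^(n + 1) E) :=
      (isLocallyConvexTopology_tensorPowerTopology hE (n + 1)).isTopologicalAddGroup
    have hR : Continuous ((q.tensorPower (n + 2)).comp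
        (tensorPowerCons 𝕜 E (n + 1)).toLinearMap) := by
      refine continuous_seminorm_finestLocallyConvexTopology _ ?_
      have hqn : Continuous (q.tensorPower (n + 1)) := continuous_tensorPower hE hq (n + 1)
      intro z₀
      refine @Seminorm.tendsto_bilin_sub 𝕜 _ E (⨂[𝕜]^(n + 1) E) (E ⊗[𝕜] (⨂[𝕜]^(n + 1) E)) _ _ _ _ _ _
        t _ _ this (TensorProduct.mk 𝕜 E _) _ _ _ hq hqn ?_ z₀
      exact fun x y => q.tensorPower_cons_le x y
    let := tensorPowerTopology 𝕜 E (n + 2)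
    have hc : Continuous (tensorPowerCons 𝕜 E (n + 1)).symm := continuous_induced_dom
    refine (continuous_congr fun x => ?_).1 (hR.comp hc)
    simp

/-- A continuous seminorm on `T^n_π(E)` is dominated on pure tensors by a multiple of a product of
values of one continuous seminorm on `E`. -/
theorem Seminorm.exists_tprod_le (hE : IsLocallyConvexTopology 𝕜 t) :
    ∀ (n : ℕ) (P : Seminorm 𝕜 (⨂[𝕜]^n E)), Continuous[tensorPowerTopology 𝕜 E n, _] P →
      ∃ q : Seminorm 𝕜 E, Continuous q ∧ ∃ C : ℝ, 0 ≤ C ∧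
        ∀ y, P (PiTensorProduct.tprod 𝕜 y) ≤ C * ∏ i, q (y i)
  | 0, P, _ => ⟨0, continuous_const, P (PiTensorProduct.tprod 𝕜 0), apply_nonneg _ _, fun y => by
      simp [Subsingleton.elim y 0]⟩
  | 1, P, hP => by
    let e : (⨂[𝕜]^1 E) ≃ₗ[𝕜] E := PiTensorProduct.subsingletonEquiv (0 : Fin 1)
    let := tensorPowerTopology 𝕜 E 1
    have hc : Continuous e.symm := continuous_induced_rng.2 (by
      convert continuous_id
      funext x
      exact e.apply_symm_apply x)
    refine ⟨P.comp e.symm.toLinearMap, hP.comp hc, 1, zero_le_one, fun y => le_of_eq ?_⟩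
    have : PiTensorProduct.tprod 𝕜 y = e.symm (y 0) := by
      apply e.injective
      simp [e]
    simp [this]
  | n + 2, P, hP => by
    let := tensorPowerTopology 𝕜 E (n + 2)
    let := tensorPowerTopology 𝕜 E (n + 1)
    let tp : TopologicalSpace (E ⊗[𝕜] (⨂[𝕜]^(n + 1) E)) := projTopology 𝕜 E (⨂[𝕜]^(n + 1) E)
    have hlc := isLocallyConvexTopology_tensorPowerTopology hE (n + 1)
    have hc : Continuous (tensorPowerCons 𝕜 E (n + 1)) := continuous_induced_rng.2 (by
      convert continuous_id
      funext x
      exact (tensorPowerCons 𝕜 E (n + 1)).symm_apply_apply x)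
    have hm : Continuous fun p : E × (⨂[𝕜]^(n + 1) E) => p.1 ⊗ₜ[𝕜] p.2 :=
      (finestLocallyConvexTopology_isLeast 𝕜 _).1.2
    obtain ⟨q₁, P₁, hq₁, hP₁, h⟩ := hE.exists_bilin_le hlc (TensorProduct.mk 𝕜 E _)
      (P.comp (tensorPowerCons 𝕜 E (n + 1)).toLinearMap) ((hP.comp hc).comp hm)
    obtain ⟨q₂, hq₂, C, hC, hP₂⟩ := exists_tprod_le hE (n + 1) P₁ hP₁
    -- The sum dominates both `q₁`, needed for the first factor, and `q₂`, needed for the others.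
    refine ⟨q₁ + q₂, hq₁.add hq₂, C, hC, fun y => ?_⟩
    have h1 := h (y 0) (PiTensorProduct.tprod 𝕜 (Fin.tail y))
    simp only [Seminorm.comp_apply, TensorProduct.mk_apply, LinearEquiv.coe_coe,
      tensorPowerCons_tmul_tprod, Fin.cons_self_tail] at h1
    refine h1.trans ?_
    rw [Fin.prod_univ_succ, mul_left_comm]
    refine mul_le_mul ?_ ((hP₂ _).trans (mul_le_mul_of_nonneg_left ?_ hC)) (apply_nonneg _ _)
      (apply_nonneg _ _)
    · exact le_add_of_nonneg_right (apply_nonneg _ _)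
    · exact Finset.prod_le_prod (fun i _ => apply_nonneg _ _)
        fun i _ => le_add_of_nonneg_left (apply_nonneg _ _)

end ProjectiveSeminorm

/-! ### Countable domination of seminorms on `L(X)`. -/

section FreeLCS

variable {𝕜 : Type*} [RCLike 𝕜] {X : Type*} [TopologicalSpace X]

theorem FreeLCS.isLocallyConvexTopology :
    IsLocallyConvexTopology 𝕜 (inferInstance : TopologicalSpace (FreeLCS 𝕜 X)) :=
  (finestLocallyConvexTopology_isLeast 𝕜 (FreeLCS.η 𝕜 X)).1.1

theorem FreeLCS.continuous_η : Continuous (FreeLCS.η 𝕜 X) :=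
  (finestLocallyConvexTopology_isLeast 𝕜 (FreeLCS.η 𝕜 X)).1.2

theorem FreeLCS.induction_on {motive : FreeLCS 𝕜 X → Prop} (x : FreeLCS 𝕜 X)
    (zero : motive 0) (add : ∀ x y, motive x → motive y → motive (x + y))
    (smul_η : ∀ (c : 𝕜) x, motive (c • FreeLCS.η 𝕜 X x)) : motive x := by
  refine Finsupp.induction_linear (motive := motive) x zero add fun a b => ?_
  have h : (Finsupp.single a b : X →₀ 𝕜) = b • Finsupp.single a (1 : 𝕜) := by simp
  have := smul_η b a
  exact h ▸ this

/-- Countable upper bound condition: on the free locally convex space over a `k_ω`-space, every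
sequence of continuous seminorms is dominated, up to constants, by a single continuous seminorm. -/
theorem FreeLCS.exists_seminorm_ge (hX : IsKOmegaSpace X) (p : ℕ → Seminorm 𝕜 (FreeLCS 𝕜 X))
    (hp : ∀ j, Continuous (p j)) : ∃ q : Seminorm 𝕜 (FreeLCS 𝕜 X), Continuous q ∧
      ∃ c : ℕ → ℝ, (∀ j, 0 ≤ c j) ∧ ∀ j x, p j x ≤ c j * q x := by
  obtain ⟨K, hmono, hcomp, hcov, hopen⟩ := hX.exists_seq
  have hpη : ∀ j, Continuous fun x => p j (FreeLCS.η 𝕜 X x) := fun j =>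
    (hp j).comp FreeLCS.continuous_η
  have hbdd : ∀ j n, ∃ M : ℝ, ∀ x ∈ K n, p j (FreeLCS.η 𝕜 X x) ≤ M := fun j n => by
    obtain ⟨M, hM⟩ := (hcomp n).bddAbove_image (hpη j).continuousOn
    exact ⟨M, fun x hx => hM (Set.mem_image_of_mem _ hx)⟩
  choose M hM using hbdd
  -- The diagonal bound `M j j` works on every `K n` with `n ≤ j`, so `P j ≤ 2⁻ʲ` there; the `max`
  -- keeps `c j` invertible.
  let c : ℕ → NNReal := fun j => (max 1 (M j j)).toNNReal * 2 ^ j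
  have hcpos : ∀ j, 0 < c j := fun j => by positivity
  let P : ℕ → Seminorm 𝕜 (FreeLCS 𝕜 X) := fun j => (c j)⁻¹ • p j
  have hP : ∀ j x, P j x = ((c j : NNReal) : ℝ)⁻¹ * p j x := fun j x => rfl
  have hPK : ∀ n j, n ≤ j → ∀ x ∈ K n, P j (FreeLCS.η 𝕜 X x) ≤ (1 / 2) ^ j := by
    intro n j hnj x hx
    rw [hP, inv_mul_le_iff₀ (by exact_mod_cast hcpos j)]
    have h1 : ((c j : NNReal) : ℝ) * (1 / 2) ^ j = max 1 (M j j) := by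
      simp only [c, NNReal.coe_mul, NNReal.coe_pow, Real.coe_toNNReal _ (zero_le_one.trans
        (le_max_left 1 (M j j))), NNReal.coe_ofNat]
      rw [mul_assoc, ← mul_pow]
      norm_num
    rw [h1]
    exact (hM j j x (hmono hnj hx)).trans (le_max_right _ _)
  have hPc : ∀ j, Continuous (P j) := fun j => (hp j).const_smul _
  have hsumη : ∀ x, Summable fun j => P j (FreeLCS.η 𝕜 X x) := fun x => by
    obtain ⟨n, hn⟩ := Set.mem_iUnion.1 (hcov.symm ▸ Set.mem_univ x)
    refine Summable.of_norm_bounded_eventually_nat summable_geometric_two ?_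
    filter_upwards [Filter.eventually_ge_atTop n] with j hj
    rw [Real.norm_of_nonneg (apply_nonneg _ _)]
    exact hPK n j hj x hn
  have hsum : ∀ x, Summable fun j => P j x := fun x => by
    induction x using FreeLCS.induction_on with
    | zero => simp
    | add x y hx hy =>
      exact Summable.of_nonneg_of_le (fun _ => apply_nonneg _ _)
        (fun j => map_add_le_add (P j) x y) (hx.add hy)
    | smul_η a x => simpa only [map_smul_eq_mul] using (hsumη x).mul_left ‖a‖
  refine ⟨Seminorm.tsum P hsum, ?_, fun j => c j, fun j => (c j).2, fun j x => ?_⟩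
  · refine continuous_seminorm_finestLocallyConvexTopology _ fun x₀ => ?_
    have hKc : ∀ n, ContinuousOn
        (fun x => Seminorm.tsum P hsum (FreeLCS.η 𝕜 X x - FreeLCS.η 𝕜 X x₀)) (K n) := fun n => by
      obtain ⟨m, hm⟩ := Set.mem_iUnion.1 (hcov.symm ▸ Set.mem_univ x₀)
      have hterm : ∀ j, Continuous fun x => P j (FreeLCS.η 𝕜 X x - FreeLCS.η 𝕜 X x₀) := fun j => by
        have := (FreeLCS.isLocallyConvexTopology (𝕜 := 𝕜) (X := X)).isTopologicalAddGroup
        exact (hPc j).comp (FreeLCS.continuous_η.sub continuous_const)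
      have hB : ∀ j, ∃ B : ℝ, ∀ x ∈ K n, P j (FreeLCS.η 𝕜 X x - FreeLCS.η 𝕜 X x₀) ≤ B :=
        fun j => by
          obtain ⟨B, hB⟩ := (hcomp n).bddAbove_image (hterm j).continuousOn
          exact ⟨B, fun x hx => hB (Set.mem_image_of_mem _ hx)⟩
      choose B hB using hB
      -- Weierstrass majorant on `K n`: the tail bounds `x` in `K n` and `x₀` in `K m` separately,
      -- and the finitely many early terms are bounded by compactness.
      let u : ℕ → ℝ := fun j => if max n m ≤ j then 2 * (1 / 2) ^ j else B j
      have hu : Summable u := by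
        refine (summable_geometric_two.mul_left 2).congr_atTop ?_
        filter_upwards [Filter.eventually_ge_atTop (max n m)] with j hj
        simp only [u, if_pos hj]
      refine continuousOn_tsum (fun j => (hterm j).continuousOn) hu fun j x hx => ?_
      rw [Real.norm_of_nonneg (apply_nonneg _ _)]
      by_cases hj : max n m ≤ j
      · simp only [u, if_pos hj]
        refine (map_sub_le_add (P j) _ _).trans ?_
        rw [two_mul]
        exact add_le_add (hPK n j (le_of_max_le_left hj) x hx)
          (hPK m j (le_of_max_le_right hj) x₀ hm)
      · simp only [u, if_neg hj]
        exact hB j x hx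
    have hcont : Continuous
        fun x => Seminorm.tsum P hsum (FreeLCS.η 𝕜 X x - FreeLCS.η 𝕜 X x₀) := by
      -- The direct limit topology turns continuity on each `K n` into continuity on `X`.
      refine continuous_def.2 fun U hU => (hopen _).2 fun n => ?_
      exact (continuousOn_iff_continuous_domRestrict.1 (hKc n)).isOpen_preimage U hU
    exact hcont.tendsto' x₀ 0 (by simp)
  · have h1 : P j x ≤ Seminorm.tsum P hsum x :=
      (hsum x).le_tsum j fun i _ => apply_nonneg _ _
    rwa [hP, inv_mul_le_iff₀ (by exact_mod_cast hcpos j)] at h1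

end FreeLCS

/-! ### Seminorms of the box topology. -/

section DirectSum

variable {𝕜 : Type*} [RCLike 𝕜] {A : ℕ → Type*} [∀ n, AddCommGroup (A n)] [∀ n, Module 𝕜 (A n)]

theorem Seminorm.summable_directSum (p : ∀ n, Seminorm 𝕜 (A n)) (x : ⨁ n, A n) :
    Summable fun n => (p n).comp (DirectSum.component 𝕜 ℕ A n) x := by
  classical
  refine summable_of_ne_finset_zero (s := DFinsupp.support x) fun n hn => ?_
  have : x n = 0 := by simpa using hn
  simp [DirectSum.component, DFinsupp.lapply, this]

/-- The seminorm `x ↦ ∑ p_n(x_n)` on a direct sum. -/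
noncomputable def Seminorm.directSum (p : ∀ n, Seminorm 𝕜 (A n)) : Seminorm 𝕜 (⨁ n, A n) :=
  Seminorm.tsum (fun n => (p n).comp (DirectSum.component 𝕜 ℕ A n)) (Seminorm.summable_directSum p)

theorem Seminorm.directSum_apply (p : ∀ n, Seminorm 𝕜 (A n)) (x : ⨁ n, A n) :
    Seminorm.directSum p x = ∑' n, p n (x n) := rfl

theorem Seminorm.directSum_of (p : ∀ n, Seminorm 𝕜 (A n)) (n : ℕ) (a : A n) :
    Seminorm.directSum p (DirectSum.of A n a) = p n a := by
  rw [Seminorm.directSum_apply, tsum_eq_single n]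
  · rw [DirectSum.of_eq_same]
  · intro m hm
    rw [DirectSum.of_eq_of_ne _ _ _ hm, map_zero]

theorem Seminorm.le_directSum (p : ∀ n, Seminorm 𝕜 (A n)) (x : ⨁ n, A n) (n : ℕ) :
    p n (x n) ≤ Seminorm.directSum p x :=
  (Seminorm.summable_directSum p x).le_tsum n fun _ _ => apply_nonneg _ _

theorem Seminorm.le_mul_directSum {R : Seminorm 𝕜 (⨁ n, A n)} {p : ∀ n, Seminorm 𝕜 (A n)} {c : ℝ}
    (h : ∀ n a, R (DirectSum.of A n a) ≤ c * p n a) (x : ⨁ n, A n) :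
    R x ≤ c * Seminorm.directSum p x := by
  classical
  have hx := DirectSum.sum_support_of x
  have h1 : R x ≤ ∑ n ∈ DFinsupp.support x, R (DirectSum.of A n (x n)) := by
    conv_lhs => rw [← hx]
    exact Finset.le_sum_of_subadditive R (map_zero R).le (map_add_le_add R) _ _
  have h2 : Seminorm.directSum p x = ∑ n ∈ DFinsupp.support x, p n (x n) := by
    rw [Seminorm.directSum_apply]
    refine tsum_eq_sum fun n hn => ?_
    have : x n = 0 := by simpa using hn
    rw [this, map_zero]
  rw [h2, Finset.mul_sum]
  exact h1.trans (Finset.sum_le_sum fun n _ => h n _)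

/-- The box topology on a direct sum of locally convex spaces is defined by the seminorms
`x ↦ ∑ p_n(x_n)` with continuous `p_n`. -/
theorem withSeminorms_boxTopology (t : ∀ n, TopologicalSpace (A n))
    (ht : ∀ n, IsLocallyConvexTopology 𝕜 (t n)) :
    @WithSeminorms 𝕜 (⨁ n, A n) {p : ∀ n, Seminorm 𝕜 (A n) // ∀ n, Continuous (p n)} _ _ _
      (fun p => Seminorm.directSum p.1) (boxTopology t) := by
  let F : SeminormFamily 𝕜 (⨁ n, A n) {p : ∀ n, Seminorm 𝕜 (A n) // ∀ n, Continuous (p n)} :=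
    fun p => Seminorm.directSum p.1
  let T := F.moduleFilterBasis.topology
  have : Nonempty {p : ∀ n, Seminorm 𝕜 (A n) // ∀ n, Continuous (p n)} :=
    ⟨⟨fun _ => 0, fun _ => continuous_const⟩⟩
  have hF : @WithSeminorms 𝕜 (⨁ n, A n) _ _ _ _ F T := ⟨rfl⟩
  have := fun n => (ht n).isTopologicalAddGroup
  suffices boxTopology t = T by
    rw [this]
    exact hF
  apply le_antisymm
  · refine le_of_nhds_le_nhds fun x => ?_
    have := (hF.tendsto_nhds (f := @nhds _ (boxTopology t) x) id x).2 fun p ε hε => by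
      -- The radii sum to `ε / 2`, which leaves room for the strict inequality after a non-strict
      -- comparison of series.
      let U : ∀ n, Set (A n) := fun n => {z | p.1 n (z - x n) < ε / 2 / 2 / 2 ^ n}
      have hU : ∀ n, IsOpen (U n) := fun n =>
        isOpen_lt ((p.2 n).comp (continuous_id.sub continuous_const)) continuous_const
      have hV : IsOpen[boxTopology t] {y : ⨁ n, A n | ∀ n, y n ∈ U n} :=
        TopologicalSpace.isOpen_generateFrom_of_mem ⟨U, hU, rfl⟩
      have hxV : x ∈ {y : ⨁ n, A n | ∀ n, y n ∈ U n} := fun n => by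
        simp only [U, Set.mem_ofPred_eq, sub_self, map_zero]
        positivity
      refine Filter.mem_of_superset (@IsOpen.mem_nhds _ (boxTopology t) _ _ hV
        hxV) fun y hy => ?_
      have hle : Seminorm.directSum p.1 (y - x) ≤ ∑' n : ℕ, ε / 2 / 2 / 2 ^ n := by
        rw [Seminorm.directSum_apply]
        exact (Seminorm.summable_directSum p.1 (y - x)).tsum_le_tsum (fun n => (hy n).le)
          (summable_geometric_two' _)
      rw [tsum_geometric_two'] at hle
      exact hle.trans_lt (half_lt_self hε)
    exact this
  · refine le_generateFrom ?_
    rintro _ ⟨U, hU, rfl⟩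
    refine isOpen_iff_mem_nhds.2 fun x hx => ?_
    have hp : ∀ n, ∃ p : Seminorm 𝕜 (A n), Continuous p ∧ ∀ z, p (z - x n) < 1 → z ∈ U n :=
      fun n => by
        have h0 : (fun v => v + x n) ⁻¹' U n ∈ 𝓝 (0 : A n) := by
          refine (continuous_add_const (x n)).continuousAt.preimage_mem_nhds ?_
          rw [zero_add]
          exact (hU n).mem_nhds (hx n)
        obtain ⟨p, hp, hpU⟩ := (ht n).exists_seminorm_ball_subset h0
        refine ⟨p, hp, fun z hz => ?_⟩
        have := hpU (p.mem_ball_zero.2 hz)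
        simpa using this
    choose p hp hpU using hp
    -- Each `p n` is at most the sum, so the unit ball of the sum around `x` lies in the box.
    have h1 := (hF.tendsto_nhds id x).1 Filter.tendsto_id ⟨p, hp⟩ 1 one_pos
    filter_upwards [h1] with y hy n
    exact hpU n _ ((Seminorm.le_directSum p (y - x) n).trans_lt hy)

end DirectSum

/-! ### Continuity of multiplication. -/

section TensorAlgebra

variable {𝕜 : Type*} [RCLike 𝕜] {E : Type*} [AddCommGroup E] [Module 𝕜 E]
  [t : TopologicalSpace E]

/-- If every sequence of continuous seminorms on `E` is dominated, up to constants, by a continuous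
seminorm, then the projective tensor algebra of `E` is a topological algebra. -/
theorem ProjTensorAlgebra.isTopologicalAlgebraWith (hE : IsLocallyConvexTopology 𝕜 t)
    (hub : ∀ p : ℕ → Seminorm 𝕜 E, (∀ j, Continuous (p j)) → ∃ q : Seminorm 𝕜 E, Continuous q ∧
      ∃ c : ℕ → ℝ, (∀ j, 0 ≤ c j) ∧ ∀ j x, p j x ≤ c j * q x) :
    IsTopologicalAlgebraWith 𝕜 (LinearMap.mul 𝕜 (ProjTensorAlgebra 𝕜 E)) := by
  let ι := {p : ∀ n, Seminorm 𝕜 (⨂[𝕜]^n E) // ∀ n, Continuous[tensorPowerTopology 𝕜 E n, _] (p n)}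
  let F : SeminormFamily 𝕜 (ProjTensorAlgebra 𝕜 E) ι := fun p => Seminorm.directSum p.1
  have hF : WithSeminorms F := withSeminorms_boxTopology (tensorPowerTopology 𝕜 E)
    (isLocallyConvexTopology_tensorPowerTopology hE)
  have : Nonempty ι := ⟨⟨fun _ => 0, fun n => @continuous_const _ _ (tensorPowerTopology 𝕜 E n) _ _⟩⟩
  have hadd := hF.topologicalAddGroup
  refine ⟨hadd, hF.continuousSMul, ?_⟩
  have key : ∀ p : ι, ∃ S : ι, ∀ x y, F p (LinearMap.mul 𝕜 (ProjTensorAlgebra 𝕜 E) x y) ≤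
      F S x * F S y := fun p => by
    choose r hr C hC hCr using fun n => Seminorm.exists_tprod_le hE n (p.1 n) (p.2 n)
    obtain ⟨q, hq, c, hc, hcq⟩ := hub r hr
    let D : ℕ → ℝ := fun n => C n * c n ^ n
    have hD : ∀ n, 0 ≤ D n := fun n => mul_nonneg (hC n) (pow_nonneg (hc n) n)
    have hDq : ∀ n x, p.1 n x ≤ D n * q.tensorPower n x := fun n =>
      q.le_mul_tensorPower (hD n) fun y => by
        refine (hCr n y).trans ?_
        rw [mul_assoc]
        refine mul_le_mul_of_nonneg_left ?_ (hC n)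
        calc ∏ i, r n (y i) ≤ ∏ i, c n * q (y i) :=
              Finset.prod_le_prod (fun _ _ => apply_nonneg _ _) fun i _ => hcq n (y i)
          _ = c n ^ n * ∏ i, q (y i) := by simp [Finset.prod_mul_distrib]
    -- Since `i + j ≤ 2 * max i j`, the factor with the larger index already dominates `D (i + j)`;
    -- the summand `1` makes the other factor harmless.
    let a : ℕ → NNReal := fun n => 1 + ∑ m ∈ Finset.range (2 * n + 1), (D m).toNNReal
    have ha1 : ∀ n, 1 ≤ a n := fun n => le_self_add
    have ha : ∀ i j, D (i + j) ≤ a i * a j := fun i j => by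
      have hDa : ∀ m n, m ≤ 2 * n → (D m).toNNReal ≤ a n := fun m n hmn =>
        (Finset.single_le_sum (f := fun m => (D m).toNNReal) (fun _ _ => zero_le)
          (Finset.mem_range.2 (Nat.lt_succ_of_le hmn))).trans le_add_self
      have : (D (i + j)).toNNReal ≤ a i * a j := by
        rcases le_total i j with h | h
        · exact (hDa _ j (by omega)).trans (le_mul_of_one_le_left zero_le (ha1 i))
        · exact (hDa _ i (by omega)).trans (le_mul_of_one_le_right zero_le (ha1 j))
      rw [← Real.coe_toNNReal _ (hD (i + j))]
      exact_mod_cast this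
    let S : ι := ⟨fun n => a n • q.tensorPower n, fun n => by
      let := tensorPowerTopology 𝕜 E n
      exact (Seminorm.continuous_tensorPower hE hq n).const_smul (a n)⟩
    refine ⟨S, fun x y => ?_⟩
    have h1 : ∀ i (u : ⨂[𝕜]^i E) j (v : ⨂[𝕜]^j E),
        F p (LinearMap.mul 𝕜 (ProjTensorAlgebra 𝕜 E) (DirectSum.of (fun n => ⨂[𝕜]^n E) i u)
          (DirectSum.of (fun n => ⨂[𝕜]^n E) j v)) ≤ S.1 i u * S.1 j v := fun i u j v => by
      have hmul : LinearMap.mul 𝕜 (ProjTensorAlgebra 𝕜 E) (DirectSum.of (fun n => ⨂[𝕜]^n E) i u)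
          (DirectSum.of (fun n => ⨂[𝕜]^n E) j v) = DirectSum.of (fun n => ⨂[𝕜]^n E) (i + j)
            (TensorPower.mulEquiv (u ⊗ₜ[𝕜] v)) :=
        DirectSum.of_mul_of (A := fun n => ⨂[𝕜]^n E) u v
      rw [hmul]
      refine (Seminorm.directSum_of p.1 _ _).trans_le ((hDq _ _).trans ?_)
      calc D (i + j) * q.tensorPower (i + j) (TensorPower.mulEquiv (u ⊗ₜ[𝕜] v))
          ≤ (a i * a j) * (q.tensorPower i u * q.tensorPower j v) :=
            mul_le_mul (ha i j) (q.tensorPower_gMul_le u v) (apply_nonneg _ _) (by positivity)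
        _ = (a i * q.tensorPower i u) * (a j * q.tensorPower j v) := by ring
    -- The homogeneous estimate extends to finite sums first in `y`, then in `x`.
    have h2 : ∀ i (u : ⨂[𝕜]^i E), F p (LinearMap.mul 𝕜 (ProjTensorAlgebra 𝕜 E)
        (DirectSum.of (fun n => ⨂[𝕜]^n E) i u) y) ≤ S.1 i u * F S y := fun i u =>
      Seminorm.le_mul_directSum (A := fun n => ⨂[𝕜]^n E)
        (R := (F p).comp (LinearMap.mul 𝕜 (ProjTensorAlgebra 𝕜 E)
          (DirectSum.of (fun n => ⨂[𝕜]^n E) i u))) (h1 i u) y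
    have h3 := Seminorm.le_mul_directSum (A := fun n => ⨂[𝕜]^n E)
      (R := (F p).comp ((LinearMap.mul 𝕜 (ProjTensorAlgebra 𝕜 E)).flip y))
      (p := S.1) (c := F S y) (fun i u => (h2 i u).trans_eq (mul_comm _ _)) x
    exact h3.trans_eq (mul_comm _ _)
  refine continuous_iff_continuousAt.2 fun z₀ => ?_
  rw [ContinuousAt, hF.tendsto_nhds]
  intro p ε hε
  obtain ⟨S, hS⟩ := key p
  exact (Seminorm.tendsto_bilin_sub (LinearMap.mul 𝕜 (ProjTensorAlgebra 𝕜 E))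
    (hF.continuous_seminorm S) (hF.continuous_seminorm S) hS z₀).eventually_lt_const hε

end TensorAlgebra

theorem mainTheorem9 (𝕜 : Type*) [RCLike 𝕜] (X : Type*) [TopologicalSpace X]
    (hX : IsKOmegaSpace X) :
    IsTopologicalAlgebraWith 𝕜 (LinearMap.mul 𝕜 (ProjTensorAlgebra 𝕜 (FreeLCS 𝕜 X))) :=
  ProjTensorAlgebra.isTopologicalAlgebraWith FreeLCS.isLocallyConvexTopology
    (FreeLCS.exists_seminorm_ge hX)
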